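/- **Conventions.** All graphs are simple. For vertices of a connected graph, $d$ denotes the graph distance. A connected graph is *median* if for all vertices $x_1,x_2,x_3$ there is a unique vertex $m$ with $d(x_i,x_j)=d(x_i,m)+d(m,x_j)$ for all $i\neq j$. Two edges are *parallel* if they are joined by a finite sequence of edges in which consecutive edges are opposite sides of a $4$-cycle; a *hyperplane* is a parallelism class of edges. Two hyperplanes $J,K$ are *transverse*, written $J\pitchfork K$ (resp. *tangent*), if there are two distinct edges $e\in J$, $f\in K$ with a common endpoint that span (resp. do not span) a $4$-cycle. A map between graphs is *parallel-preserving* if it sends vertices to vertices, edges to edges, and parallel edges to parallel edges; for such a map $\psi$ and a hyperplane $J$, $\psi(J)$ denotes the hyperplane containing the images of the edges of $J$. An *isometric embedding* is a map between graphs preserving $d$; such a map is parallel-preserving. A set of vertices is *convex* if it contains every vertex lying on a geodesic between two of its elements, and the *convex hull* of a set is the smallest convex set containing it. **Theorem.** Let $X$ be a countable median graph and $\mathcal P$ a collection of unordered pairs of tangent hyperplanes of $X$. There exist a median graph $Z$ and an isometric embedding $\iota:X\to Z$ such that the following hold. 1. For every median graph $Y$ and every parallel-preserving map $\psi:X\to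 Y$ satisfying $\psi(A)\pitchfork\psi(B)$ for every $\{A,B\}\in\mathcal P$, there is a unique parallel-preserving map $\xi:Z\to Y$ with $\xi\circ\iota=\psi$. 2. The convex hull of $\iota(X)$ in $Z$ is all of $Z$; and two hyperplanes $J,K$ of $Z$ are transverse if and only if $J=\iota(A)$ and $K=\iota(B)$ for some hyperplanes $A,B$ of $X$ such that $A\pitchfork B$ in $X$ or $\{A,B\}\in\mathcal P$. 3. $Z$ is the unique such graph up to isometry: if $Z'$ is a median graph and $\iota':X\to Z'$ is an isometric embedding such that the two properties in (2) hold for $(Z',\iota')$ in place of $(Z,\iota)$, then there is a graph isomorphism $\varphi:Z\to Z'$ with $\varphi\circ\iota=\iota'$. -/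

import Mathlib

namespace SimpleGraph

/-- A connected graph is median if any three vertices `x, y, z` admit a unique vertex `m` lying
between any two of them. (`Connected` includes having at least one vertex.) -/
def IsMedian {V : Type*} (G : SimpleGraph V) : Prop :=
  G.Connected ∧ ∀ x y z : V, ∃! m : V,
    G.dist x y = G.dist x m + G.dist m y ∧
    G.dist y z = G.dist y m + G.dist m z ∧
    G.dist x z = G.dist x m + G.dist m z

/-- `a, b, c, d` are, in this cyclic order, the four distinct vertices of a `4`-cycle of `G`
(not required to be induced). -/
def IsFourCycle {V : Type*} (G : SimpleGraph V) (a b c d : V) : Prop :=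
  G.Adj a b ∧ G.Adj b c ∧ G.Adj c d ∧ G.Adj d a ∧ a ≠ c ∧ b ≠ d

/-- Two edges are opposite sides of some `4`-cycle. -/
def OppositeEdges {V : Type*} (G : SimpleGraph V) (e f : G.edgeSet) : Prop :=
  ∃ a b c d : V, G.IsFourCycle a b c d ∧ (e : Sym2 V) = s(a, b) ∧ (f : Sym2 V) = s(c, d)

/-- Two edges are parallel if they are joined by a finite sequence of edges (possibly of length
zero) in which any two consecutive edges are opposite sides of a `4`-cycle. -/
def ParallelEdges {V : Type*} (G : SimpleGraph V) (e f : G.edgeSet) : Prop :=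
  Relation.ReflTransGen G.OppositeEdges e f

theorem OppositeEdges.symm {V : Type*} {G : SimpleGraph V} {e f : G.edgeSet}
    (h : G.OppositeEdges e f) : G.OppositeEdges f e := by
  obtain ⟨a, b, c, d, ⟨h1, h2, h3, h4, h5, h6⟩, he, hf⟩ := h
  exact ⟨c, d, a, b, ⟨h3, h4, h1, h2, h5.symm, h6.symm⟩, hf, he⟩

theorem ParallelEdges.symm {V : Type*} {G : SimpleGraph V} {e f : G.edgeSet}
    (h : G.ParallelEdges e f) : G.ParallelEdges f e := by
  unfold ParallelEdges at h ⊢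
  induction h with
  | refl => exact Relation.ReflTransGen.refl
  | tail _ h ih => exact Relation.ReflTransGen.head h.symm ih

/-- Parallelism as an equivalence relation on the edges. -/
def parallelSetoid {V : Type*} (G : SimpleGraph V) : Setoid G.edgeSet where
  r := G.ParallelEdges
  iseqv := ⟨fun _ => Relation.ReflTransGen.refl, ParallelEdges.symm, Relation.ReflTransGen.trans⟩

/-- A hyperplane is a parallelism class of edges. -/
def Hyperplane {V : Type*} (G : SimpleGraph V) : Type _ :=
  Quotient G.parallelSetoid

/-- The hyperplane containing the edge with endpoints `a` and `b`. -/
def hyperplaneOf {V : Type*} (G : SimpleGraph V) {a b : V} (h : G.Adj a b) : G.Hyperplane :=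
  Quotient.mk G.parallelSetoid ⟨s(a, b), h⟩

/-- The edges `[o, a]` and `[o, b]` span a `4`-cycle. -/
def SpanFourCycle {V : Type*} (G : SimpleGraph V) (o a b : V) : Prop :=
  ∃ c : V, G.IsFourCycle o a c b

/-- Two hyperplanes are transverse if they contain two intersecting edges that span a
`4`-cycle. -/
def Transverse {V : Type*} (G : SimpleGraph V) (J K : G.Hyperplane) : Prop :=
  ∃ (o a b : V) (ha : G.Adj o a) (hb : G.Adj o b),
    a ≠ b ∧ G.hyperplaneOf ha = J ∧ G.hyperplaneOf hb = K ∧ G.SpanFourCycle o a b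

/-- Two hyperplanes are tangent if they contain two (distinct) intersecting edges that do not
span a `4`-cycle. -/
def Tangent {V : Type*} (G : SimpleGraph V) (J K : G.Hyperplane) : Prop :=
  ∃ (o a b : V) (ha : G.Adj o a) (hb : G.Adj o b),
    a ≠ b ∧ G.hyperplaneOf ha = J ∧ G.hyperplaneOf hb = K ∧ ¬ G.SpanFourCycle o a b

/-- A map between graphs that sends vertices to vertices and edges to edges is
parallel-preserving if it sends parallel edges to parallel edges. -/
def ParallelPreserving {V W : Type*} {G : SimpleGraph V} {H : SimpleGraph W} (ψ : G →g H) :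
    Prop :=
  ∀ e f : G.edgeSet, G.ParallelEdges e f → H.ParallelEdges (ψ.mapEdgeSet e) (ψ.mapEdgeSet f)

/-- The image `ψ(J)` of a hyperplane `J`: the hyperplane of the target that contains the images
of the edges of `J`. -/
def Hyperplane.image {V W : Type*} {G : SimpleGraph V} {H : SimpleGraph W} (ψ : G →g H)
    (hψ : ParallelPreserving ψ) (J : G.Hyperplane) : H.Hyperplane :=
  Quotient.map (sa := G.parallelSetoid) (sb := H.parallelSetoid) ψ.mapEdgeSet hψ J

/-- A graph embedding sends opposite sides of a `4`-cycle to opposite sides of a `4`-cycle. -/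
theorem Embedding.oppositeEdges {V W : Type*} {G : SimpleGraph V} {H : SimpleGraph W}
    (ι : G ↪g H) {e f : G.edgeSet} (h : G.OppositeEdges e f) :
    H.OppositeEdges (ι.toHom.mapEdgeSet e) (ι.toHom.mapEdgeSet f) := by
  obtain ⟨e, he'⟩ := e
  obtain ⟨f, hf'⟩ := f
  obtain ⟨a, b, c, d, ⟨h1, h2, h3, h4, h5, h6⟩, he, hf⟩ := h
  simp only at he hf
  subst he hf
  exact ⟨ι a, ι b, ι c, ι d, ⟨ι.map_adj_iff.2 h1, ι.map_adj_iff.2 h2, ι.map_adj_iff.2 h3,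
    ι.map_adj_iff.2 h4, ι.injective.ne h5, ι.injective.ne h6⟩, rfl, rfl⟩

/-- A graph embedding is parallel-preserving. -/
theorem Embedding.parallelPreserving {V W : Type*} {G : SimpleGraph V} {H : SimpleGraph W}
    (ι : G ↪g H) : ParallelPreserving ι.toHom := by
  intro e f h
  unfold ParallelEdges at h ⊢
  induction h with
  | refl => exact Relation.ReflTransGen.refl
  | tail _ h ih => exact ih.tail (ι.oppositeEdges h)

/-- A graph embedding is isometric if it preserves the graph distance. -/
def IsIsometric {V W : Type*} {G : SimpleGraph V} {H : SimpleGraph W} (ι : G ↪g H) : Prop :=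
  ∀ x y : V, H.dist (ι x) (ι y) = G.dist x y

/-- A set of vertices of a (connected) graph is convex if it contains every vertex lying on a
geodesic between two of its elements. -/
def IsGeodesicallyConvex {V : Type*} (G : SimpleGraph V) (C : Set V) : Prop :=
  ∀ x ∈ C, ∀ y ∈ C, ∀ z : V, G.dist x z + G.dist z y = G.dist x y → z ∈ C

/-- The convex hull of a set of vertices: the smallest convex set containing it. -/
def geodesicConvexHull {V : Type*} (G : SimpleGraph V) (S : Set V) : Set V :=
  ⋂₀ {C | S ⊆ C ∧ G.IsGeodesicallyConvex C}

/-- For an isometric embedding `ι` of `X` in `Z`: the graph `Z` is the convex hull of (the image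
of) `X`, and two hyperplanes of `Z` are transverse if and only if they are the images of two
hyperplanes of `X` that are transverse in `X` or form a pair in `P`. -/
structure IsHullWithTransversality {V W : Type*} {X : SimpleGraph V} {Z : SimpleGraph W}
    (P : Set (Sym2 X.Hyperplane)) (ι : X ↪g Z) : Prop where
  hull : Z.geodesicConvexHull (Set.range ι) = Set.univ
  transverse_iff : ∀ J K : Z.Hyperplane, Z.Transverse J K ↔
    ∃ A B : X.Hyperplane,
      Hyperplane.image ι.toHom ι.parallelPreserving A = J ∧
      Hyperplane.image ι.toHom ι.parallelPreserving B = K ∧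
      (X.Transverse A B ∨ s(A, B) ∈ P)

end SimpleGraph

universe u v w

/-! A median graph is encoded by how its hyperplanes cut the vertex set: each has two sides,
distance counts separating hyperplanes (`IsMedian.ncard_disagreement`), and a vertex is determined
by its sides. By the Helly property (`IsMedian.exists_forall_side_iff`), a choice of sides differing
finitely often from that of a vertex comes from a vertex as soon as the chosen halfspaces meet
pairwise.

The completion `Z` keeps the finiteness but asks for pairwise meeting only off `P` (`Orientation`).
Edges flip one side, and medians are coordinatewise majorities. Thus `Z` has the same hyperplanes as
`X`. Two of them are transverse exactly when their four quadrants are nonempty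
(`IsMedian.transverse_iff`), and this happens for the old transverse pairs and for `P`; tangency
provides the two edges whose missing square is filled.

The universal property and the uniqueness both come from Helly in the target. An orientation
prescribes a side of every hyperplane of `Y`, and these sides meet pairwise because pairs in `P`
become transverse. In a competitor `Z'`, the hull condition makes every hyperplane come from `X` and
the transversality condition tells which sides meet, so its vertices are exactly the orientations.
-/

namespace SimpleGraph

/-! ### Labellings and their Hamming distance -/

/-- The indices at which two propositional labellings disagree. -/
def disagreement {H : Type*} (σ τ : H → Prop) : Set H := {A | ¬(σ A ↔ τ A)}

theorem mem_disagreement {H : Type*} {σ τ : H → Prop} {A : H} :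
    A ∈ disagreement σ τ ↔ ¬(σ A ↔ τ A) := Iff.rfl

theorem disagreement_comm {H : Type*} (σ τ : H → Prop) :
    disagreement σ τ = disagreement τ σ := by
  ext A; simp only [mem_disagreement]; tauto

theorem disagreement_subset_union {H : Type*} (σ μ τ : H → Prop) :
    disagreement σ τ ⊆ disagreement σ μ ∪ disagreement μ τ := by
  intro A; simp only [mem_disagreement, Set.mem_union]; tauto

/-- The left set always lies in the union of the other two; equality of cardinals means that these
are disjoint, so `μ` never leaves a common value of `σ` and `τ`. -/
theorem ncard_disagreement_eq_add_iff {H : Type*} {σ μ τ : H → Prop}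
    (h₁ : (disagreement σ μ).Finite) (h₂ : (disagreement μ τ).Finite) :
    (disagreement σ τ).ncard = (disagreement σ μ).ncard + (disagreement μ τ).ncard ↔
      ∀ A, (σ A ↔ τ A) → (μ A ↔ σ A) := by
  constructor
  · intro h A hA
    by_contra hn
    have hss : disagreement σ τ ⊂ disagreement σ μ ∪ disagreement μ τ := by
      refine ⟨disagreement_subset_union σ μ τ, fun hs => ?_⟩
      have : A ∈ disagreement σ τ := hs (by left; simp only [mem_disagreement]; tauto)
      exact this hA
    have := Set.ncard_lt_ncard hss (h₁.union h₂)
    have := Set.ncard_union_le (disagreement σ μ) (disagreement μ τ)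
    omega
  · intro h
    rw [← Set.ncard_union_eq _ h₁ h₂]
    · congr 1
      ext A
      have := h A
      simp only [mem_disagreement, Set.mem_union]; tauto
    · rw [Set.disjoint_left]
      intro A
      have := h A
      simp only [mem_disagreement]; tauto

variable {V : Type*} {G : SimpleGraph V}

/-! ### The two sides of a hyperplane -/

theorem Connected.exists_adj_dist_eq (hG : G.Connected) {a c : V} {n : ℕ}
    (h : G.dist a c = n + 1) : ∃ a', G.Adj a a' ∧ G.dist a' c = n := by
  obtain ⟨p, hp⟩ := hG.exists_walk_length_eq_dist a c
  cases p with
  | nil => simp at h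
  | cons hadj q =>
    refine ⟨_, hadj, ?_⟩
    rw [Walk.length_cons] at hp
    have h1 := dist_le q
    rename_i v
    have h4 := hG.dist_triangle (u := a) (v := v) (w := c)
    rw [dist_eq_one_iff_adj.2 hadj] at h4
    omega

/-- Median graphs are bipartite: the median of `a`, `b`, `x` lies between `a` and `b`, so it is one
of them. -/
theorem IsMedian.dist_of_adj (hG : G.IsMedian) {a b : V} (h : G.Adj a b) (x : V) :
    G.dist x b = G.dist x a + 1 ∨ G.dist x a = G.dist x b + 1 := by
  obtain ⟨m, ⟨h1, h2, h3⟩, -⟩ := hG.2 a b x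
  have hab := dist_eq_one_iff_adj.2 h
  rw [hab] at h1
  rw [G.dist_comm (u := x) (v := b), G.dist_comm (u := x) (v := a)]
  rcases Nat.eq_zero_or_pos (G.dist a m) with h0 | h0
  · rw [hG.1.dist_eq_zero_iff] at h0
    subst h0
    have h4 := dist_eq_one_iff_adj.2 h.symm
    omega
  · have h0 : G.dist m b = 0 := by omega
    rw [hG.1.dist_eq_zero_iff] at h0
    subst h0
    omega

/-- Otherwise parity forces `a` and `c` to be equally far from `x`, one step nearer than `b` and
`d`. Both are then medians of `x`, `b`, `d`. -/
theorem IsMedian.closer_fourCycle (hG : G.IsMedian) {a b c d : V} (h : G.IsFourCycle a b c d)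
    (x : V) : G.dist x a < G.dist x b ↔ G.dist x d < G.dist x c := by
  have key : ∀ {a b c d : V}, G.IsFourCycle a b c d → G.dist x a < G.dist x b →
      G.dist x d < G.dist x c := by
    rintro a b c d ⟨hab, hbc, hcd, hda, hac, hbd⟩ hlt
    by_contra hn
    have e1 := hG.dist_of_adj hab x
    have e2 := hG.dist_of_adj hbc x
    have e3 := hG.dist_of_adj hcd x
    have e4 := hG.dist_of_adj hda x
    have hb : G.dist b d = 2 := by
      have h1 := hG.dist_of_adj hcd b
      have h2 : G.dist b d ≠ 0 := by rwa [Ne, hG.1.dist_eq_zero_iff]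
      rw [dist_eq_one_iff_adj.2 hbc] at h1
      omega
    apply hac
    refine (hG.2 x b d).unique ⟨?_, ?_, ?_⟩ ⟨?_, ?_, ?_⟩
    · rw [dist_eq_one_iff_adj.2 hab]; omega
    · rw [dist_eq_one_iff_adj.2 hab.symm, dist_eq_one_iff_adj.2 hda.symm]; omega
    · rw [dist_eq_one_iff_adj.2 hda.symm]; omega
    · rw [dist_eq_one_iff_adj.2 hbc.symm]; omega
    · rw [dist_eq_one_iff_adj.2 hbc, dist_eq_one_iff_adj.2 hcd]; omega
    · rw [dist_eq_one_iff_adj.2 hcd]; omega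
  obtain ⟨hab, hbc, hcd, hda, hac, hbd⟩ := h
  exact ⟨key ⟨hab, hbc, hcd, hda, hac, hbd⟩,
    key ⟨hcd.symm, hbc.symm, hab.symm, hda.symm, hbd.symm, hac.symm⟩⟩

/-- Edges are unordered, so what parallelism preserves is the partition into two sides; hence the
comparison of two vertices `x` and `y`. -/
theorem IsMedian.closer_iff_of_parallel (hG : G.IsMedian) {e f : G.edgeSet}
    (h : G.ParallelEdges e f) {a b c d : V} (he : (e : Sym2 V) = s(a, b))
    (hf : (f : Sym2 V) = s(c, d)) (x y : V) :
    (G.dist x a < G.dist x b ↔ G.dist y a < G.dist y b) ↔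
      (G.dist x c < G.dist x d ↔ G.dist y c < G.dist y d) := by
  have swap : ∀ {a b c d : V}, G.Adj a b → s(a, b) = s(c, d) →
      ((G.dist x a < G.dist x b ↔ G.dist y a < G.dist y b) ↔
      (G.dist x c < G.dist x d ↔ G.dist y c < G.dist y d)) := by
    intro a b c d hadj h
    rcases Sym2.eq_iff.1 h with ⟨rfl, rfl⟩ | ⟨rfl, rfl⟩
    · rfl
    · have e1 := hG.dist_of_adj hadj x
      have e2 := hG.dist_of_adj hadj y
      omega
  unfold ParallelEdges at h
  induction h generalizing c d with
  | refl =>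
    refine swap ?_ (he.symm.trans hf)
    have := e.2
    rwa [he] at this
  | tail _ hop ih =>
    obtain ⟨p, q, r, s, hc, h1, h2⟩ := hop
    refine (ih h1).trans (Iff.trans ?_ (swap hc.2.2.1 (h2.symm.trans hf)))
    rw [hG.closer_fourCycle hc x, hG.closer_fourCycle hc y]
    have e1 := hG.dist_of_adj hc.2.2.1 x
    have e2 := hG.dist_of_adj hc.2.2.1 y
    omega

/-- The side of a hyperplane on which a vertex lies, with respect to an arbitrary choice of one
of the two sides. -/
def Hyperplane.side (J : G.Hyperplane) (x : V) : Prop :=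
  G.dist x (Quot.out (Quotient.out J : G.edgeSet).1).1 <
    G.dist x (Quot.out (Quotient.out J : G.edgeSet).1).2

theorem Hyperplane.exists_adj (J : G.Hyperplane) :
    ∃ (a b : V) (h : G.Adj a b), G.hyperplaneOf h = J := by
  obtain ⟨⟨e, he⟩, rfl⟩ := Quotient.exists_rep J
  induction e using Sym2.ind with
  | _ a b => exact ⟨a, b, he, rfl⟩

theorem hyperplaneOf_symm {a b : V} (h : G.Adj a b) :
    G.hyperplaneOf h.symm = G.hyperplaneOf h := by
  unfold hyperplaneOf
  congr 2
  exact Sym2.eq_swap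

theorem IsFourCycle.hyperplaneOf_eq {a b c d : V} (h : G.IsFourCycle a b c d) :
    G.hyperplaneOf h.1 = G.hyperplaneOf h.2.2.1 :=
  Quotient.sound (s := G.parallelSetoid)
    (Relation.ReflTransGen.single ⟨a, b, c, d, h, rfl, rfl⟩)

theorem IsMedian.side_iff_side (hG : G.IsMedian) {a b : V} (h : G.Adj a b) (x y : V) :
    ((G.hyperplaneOf h).side x ↔ (G.hyperplaneOf h).side y) ↔
      (G.dist x a < G.dist x b ↔ G.dist y a < G.dist y b) := by
  refine hG.closer_iff_of_parallel (e := Quotient.out (G.hyperplaneOf h)) (f := ⟨s(a, b), h⟩)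
    ?_ ?_ rfl x y
  · exact Quotient.exact (s := G.parallelSetoid) (Quotient.out_eq _)
  · exact (Quot.out_eq _).symm

/-- The first square of a ladder from `ab` to `cd`: `a'` follows `a` on a geodesic to `c`, and the
median `m` of `a'`, `b`, `d` closes the square. -/
theorem IsMedian.ladder_step (hG : G.IsMedian) {n : ℕ} {a b c d : V} (hab : G.Adj a b)
    (hcd : G.Adj c d) (hac : G.dist a c = n + 1) (hbd : G.dist b d = n + 1)
    (had : G.dist a d = n + 2) (hbc : G.dist b c = n + 2) :
    ∃ a' m, G.IsFourCycle a b m a' ∧ G.dist a' c = n ∧ G.dist m d = n ∧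
      G.dist a' d = n + 1 ∧ G.dist m c = n + 1 := by
  obtain ⟨a', haa', ha'c⟩ := hG.1.exists_adj_dist_eq hac
  have t1 := dist_eq_one_iff_adj.2 haa'
  have t2 := dist_eq_one_iff_adj.2 hab
  have t3 := hG.1.dist_triangle (u := a) (v := a') (w := d)
  have e1 := hG.dist_of_adj hcd a'
  have e2 := hG.dist_of_adj haa' b
  have t4 := hG.1.dist_triangle (u := b) (v := a') (w := c)
  have t5 : G.dist b a = 1 := by rw [G.dist_comm]; exact t2
  obtain ⟨m, ⟨h1, h2, h3⟩, -⟩ := hG.2 a' b d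
  have t6 : G.dist b a' = G.dist a' b := G.dist_comm
  have t7 : G.dist b m = G.dist m b := G.dist_comm
  have hbm : G.Adj b m := dist_eq_one_iff_adj.1 (by omega)
  have ham : G.Adj a' m := dist_eq_one_iff_adj.1 (by omega)
  have t8 := hG.1.dist_triangle (u := b) (v := m) (w := c)
  have t9 := hG.1.dist_triangle (u := m) (v := a') (w := c)
  have t10 : G.dist m a' = G.dist a' m := G.dist_comm
  refine ⟨a', m, ⟨hab, hbm, ham.symm, haa'.symm, ?_, ?_⟩, ha'c, ?_, ?_, ?_⟩
  · rintro rfl; omega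
  · rintro rfl; simp at e2; omega
  all_goals omega

theorem IsMedian.hyperplaneOf_eq_of_dist (hG : G.IsMedian) {n : ℕ} {a b c d : V}
    (hab : G.Adj a b) (hcd : G.Adj c d) (hac : G.dist a c = n) (hbd : G.dist b d = n)
    (had : G.dist a d = n + 1) (hbc : G.dist b c = n + 1) :
    G.hyperplaneOf hab = G.hyperplaneOf hcd := by
  induction n generalizing a b with
  | zero =>
    rw [hG.1.dist_eq_zero_iff] at hac hbd
    subst hac hbd
    rfl
  | succ n ih =>
    obtain ⟨a', m, h, h1, h2, h3, h4⟩ := hG.ladder_step hab hcd hac hbd had hbc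
    rw [h.hyperplaneOf_eq, ← hyperplaneOf_symm]
    exact ih _ h1 h2 h3 h4

/-- An edge whose endpoints lie on opposite sides of a hyperplane belongs to that hyperplane, and
conversely. -/
theorem IsMedian.side_iff_of_adj (hG : G.IsMedian) {c d : V} (hcd : G.Adj c d)
    (J : G.Hyperplane) : (J.side c ↔ J.side d) ↔ J ≠ G.hyperplaneOf hcd := by
  constructor
  · rintro h rfl
    rw [hG.side_iff_side] at h
    have := dist_eq_one_iff_adj.2 hcd
    have := dist_eq_one_iff_adj.2 hcd.symm
    simp only [dist_self] at h
    omega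
  · obtain ⟨a, b, hab, rfl⟩ := J.exists_adj
    intro hne
    by_contra h
    rw [hG.side_iff_side] at h
    -- If `ab` puts `c` and `d` on different sides, parity gives exactly the distances needed to run
    -- a ladder from `ab` to `cd`.
    have key : ∀ {c d : V} (hcd : G.Adj c d), G.dist c a < G.dist c b →
        ¬ G.dist d a < G.dist d b → G.hyperplaneOf hab = G.hyperplaneOf hcd := by
      intro c d hcd h1 h2
      have e1 := hG.dist_of_adj hab c
      have e2 := hG.dist_of_adj hab d
      have e3 := hG.dist_of_adj hcd a
      have e4 := hG.dist_of_adj hcd b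
      have s1 : G.dist a c = G.dist c a := G.dist_comm
      have s2 : G.dist b c = G.dist c b := G.dist_comm
      have s3 : G.dist a d = G.dist d a := G.dist_comm
      have s4 : G.dist b d = G.dist d b := G.dist_comm
      exact hG.hyperplaneOf_eq_of_dist (n := G.dist a c) hab hcd rfl (by omega) (by omega)
        (by omega)
    by_cases hc : G.dist c a < G.dist c b
    · exact hne (key hcd hc (by tauto))
    · exact hne ((key hcd.symm (by tauto) hc).trans (hyperplaneOf_symm hcd))

/-! ### Distance counts separating hyperplanes -/

/-- The sides on which a vertex lies, as a labelling of the hyperplanes. -/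
def sides (x : V) : G.Hyperplane → Prop := fun J => J.side x

/-- Each step of a geodesic from `x` to `y` removes one disagreement, the hyperplane just crossed.
Using `encard` yields finiteness at the same time. -/
theorem IsMedian.encard_disagreement (hG : G.IsMedian) (x y : V) :
    (disagreement (G.sides x) (G.sides y)).encard = G.dist x y := by
  induction hn : G.dist x y generalizing x with
  | zero =>
    rw [hG.1.dist_eq_zero_iff] at hn
    subst hn
    simp [disagreement]
  | succ n ih =>
    obtain ⟨x', hx, hn'⟩ := hG.1.exists_adj_dist_eq hn
    have hJ : (G.hyperplaneOf hx).side x' ↔ (G.hyperplaneOf hx).side y := by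
      rw [hG.side_iff_side]
      have := dist_eq_one_iff_adj.2 hx.symm
      have e1 : G.dist y x' = G.dist x' y := G.dist_comm
      have e2 : G.dist y x = G.dist x y := G.dist_comm
      simp only [dist_self]
      omega
    have : disagreement (G.sides x) (G.sides y) =
        insert (G.hyperplaneOf hx) (disagreement (G.sides x') (G.sides y)) := by
      ext K
      have := hG.side_iff_of_adj hx K
      simp only [mem_disagreement, Set.mem_insert_iff, sides]
      by_cases h : K = G.hyperplaneOf hx
      · subst h; tauto
      · tauto
    rw [this, Set.encard_insert_of_notMem, ih x' hn']
    · push_cast; rfl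
    · simpa [mem_disagreement, sides] using hJ

theorem IsMedian.finite_disagreement (hG : G.IsMedian) (x y : V) :
    (disagreement (G.sides x) (G.sides y)).Finite :=
  Set.finite_of_encard_eq_coe (hG.encard_disagreement x y)

theorem IsMedian.ncard_disagreement (hG : G.IsMedian) (x y : V) :
    (disagreement (G.sides x) (G.sides y)).ncard = G.dist x y := by
  rw [Set.ncard, hG.encard_disagreement]; rfl

theorem IsMedian.eq_of_sides (hG : G.IsMedian) {x y : V}
    (h : ∀ J : G.Hyperplane, J.side x ↔ J.side y) : x = y := by
  rw [← hG.1.dist_eq_zero_iff, ← hG.ncard_disagreement, Set.ncard_eq_zero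
    (hG.finite_disagreement x y)]
  ext J
  simpa [mem_disagreement, sides] using h J

theorem IsMedian.between_iff (hG : G.IsMedian) {x z y : V} :
    G.dist x y = G.dist x z + G.dist z y ↔
      ∀ J : G.Hyperplane, (J.side x ↔ J.side y) → (J.side z ↔ J.side x) := by
  rw [← hG.ncard_disagreement, ← hG.ncard_disagreement, ← hG.ncard_disagreement]
  exact ncard_disagreement_eq_add_iff (hG.finite_disagreement x z) (hG.finite_disagreement z y)

theorem IsMedian.exists_majority (hG : G.IsMedian) (x y z : V) :
    ∃ m, ∀ J : G.Hyperplane, ((J.side x ↔ J.side y) → (J.side m ↔ J.side x)) ∧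
      ((J.side y ↔ J.side z) → (J.side m ↔ J.side y)) ∧
      ((J.side x ↔ J.side z) → (J.side m ↔ J.side x)) := by
  obtain ⟨m, ⟨h1, h2, h3⟩, -⟩ := hG.2 x y z
  rw [hG.between_iff] at h1 h2 h3
  exact ⟨m, fun J => ⟨h1 J, h2 J, h3 J⟩⟩

theorem IsMedian.eq_of_hyperplaneOf_eq (hG : G.IsMedian) {x y z : V} (hy : G.Adj x y)
    (hz : G.Adj x z) (h : G.hyperplaneOf hy = G.hyperplaneOf hz) : y = z := by
  refine hG.eq_of_sides fun J => ?_
  have h1 := hG.side_iff_of_adj hy J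
  have h2 := hG.side_iff_of_adj hz J
  rw [h] at h1
  tauto

/-- One implication suffices: a hyperplane other than `B` does not separate the endpoints of an edge
of `B`. -/
theorem IsMedian.hyperplane_ext (hG : G.IsMedian) {A B : G.Hyperplane}
    (h : ∀ x y, (A.side x ↔ A.side y) → (B.side x ↔ B.side y)) : A = B := by
  obtain ⟨a, b, hab, rfl⟩ := B.exists_adj
  by_contra hne
  exact (hG.side_iff_of_adj hab _).1 (h a b ((hG.side_iff_of_adj hab A).2 hne)) rfl

theorem IsMedian.exists_side_iff (hG : G.IsMedian) (A : G.Hyperplane) (s : Prop) :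
    ∃ x, A.side x ↔ s := by
  obtain ⟨a, b, hab, rfl⟩ := A.exists_adj
  have := hG.side_iff_of_adj hab (G.hyperplaneOf hab)
  by_cases h : (G.hyperplaneOf hab).side a ↔ s
  · exact ⟨a, h⟩
  · exact ⟨b, by tauto⟩

/-! ### Gates and the Helly property -/

/-- A hyperplane separating a vertex `v` from its nearest point `q` in a halfspace separates `v`
from the whole halfspace. -/
theorem IsMedian.exists_gate (hG : G.IsMedian) (K : G.Hyperplane) (s : Prop) (v : V) :
    ∃ q, (K.side q ↔ s) ∧ ∀ y, (K.side y ↔ s) → ∀ B : G.Hyperplane,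
      ¬ (B.side v ↔ B.side q) → (B.side y ↔ B.side q) := by
  obtain ⟨q, hq, hmin⟩ := (measure (G.dist v)).wf.has_min {x | K.side x ↔ s}
    (hG.exists_side_iff K s)
  refine ⟨q, hq, fun y hy B hB => ?_⟩
  -- The median lies in the halfspace, between `q` and `y`, and also between `v` and `q`. Minimality
  -- gives `m = q`, so `q` is between `v` and `y`.
  obtain ⟨m, ⟨h1, h2, h3⟩, -⟩ := hG.2 v q y
  have hm : m ∈ {x | K.side x ↔ s} := by
    have := hG.between_iff.1 h2 K
    simp only [Set.mem_ofPred_eq] at hq ⊢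
    tauto
  have hm' : ¬ G.dist v m < G.dist v q := hmin m hm
  have h0 : G.dist m q = 0 := by omega
  rw [hG.1.dist_eq_zero_iff] at h0
  subst h0
  have := hG.between_iff.1 h3 B
  tauto

/-- Helly property: a pairwise realizable choice of sides that differs only finitely often from
that of a vertex is realized by a vertex. -/
theorem IsMedian.exists_forall_side_iff (hG : G.IsMedian) (F : Set G.Hyperplane)
    (o : G.Hyperplane → Prop) (v : V) (hfin : {K ∈ F | ¬ (K.side v ↔ o K)}.Finite)
    (hpair : ∀ K ∈ F, ∀ L ∈ F, ∃ x, (K.side x ↔ o K) ∧ (L.side x ↔ o L)) :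
    ∃ x, ∀ K ∈ F, K.side x ↔ o K := by
  induction hn : {K ∈ F | ¬ (K.side v ↔ o K)}.ncard using Nat.strong_induction_on
    generalizing v with
  | _ n ih =>
    by_cases hK : ∃ K ∈ F, ¬ (K.side v ↔ o K)
    · obtain ⟨K, hKF, hK⟩ := hK
      obtain ⟨q, hq, hgate⟩ := hG.exists_gate K (o K) v
      -- Moving to the gate repairs `K` and spoils nothing: a spoiled `B` would separate `v` from
      -- the whole chosen halfspace of `K`, against `hpair`.
      have hss : {K ∈ F | ¬ (K.side q ↔ o K)} ⊂ {K ∈ F | ¬ (K.side v ↔ o K)} := by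
        refine ⟨?_, fun hs => (hs ⟨hKF, hK⟩).2 hq⟩
        rintro B ⟨hBF, hB⟩
        refine ⟨hBF, fun hBv => hB ?_⟩
        obtain ⟨y, hy, hy'⟩ := hpair K hKF B hBF
        have := hgate y hy B
        tauto
      exact ih _ (hn ▸ Set.ncard_lt_ncard hss hfin) q (hfin.subset hss.1) rfl
    · exact ⟨v, fun K hKF => by by_contra h; exact hK ⟨K, hKF, h⟩⟩

/-! ### Transversality and quadrants -/

/-- `B` separates the ends of one rail of the ladder, so it crosses that rail somewhere; the square
at the crossing shows transversality. -/
theorem IsMedian.transverse_of_ladder (hG : G.IsMedian) {n : ℕ} {a b c d : V}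
    (hab : G.Adj a b) (hcd : G.Adj c d) (hac : G.dist a c = n) (hbd : G.dist b d = n)
    (had : G.dist a d = n + 1) (hbc : G.dist b c = n + 1) {B : G.Hyperplane}
    (hB : ¬ (B.side a ↔ B.side c)) : G.Transverse (G.hyperplaneOf hab) B := by
  induction n generalizing a b with
  | zero =>
    rw [hG.1.dist_eq_zero_iff] at hac
    subst hac
    exact absurd Iff.rfl hB
  | succ n ih =>
    obtain ⟨a', m, h, h1, h2, h3, h4⟩ := hG.ladder_step hab hcd hac hbd had hbc
    by_cases hBa : B.side a ↔ B.side a'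
    · rw [h.hyperplaneOf_eq, ← hyperplaneOf_symm]
      exact ih _ h1 h2 h3 h4 (by rwa [← hBa])
    · refine ⟨a, b, a', hab, h.2.2.2.1.symm, h.2.2.2.2.2, rfl, ?_, m, h⟩
      by_contra hne
      exact hBa ((hG.side_iff_of_adj _ B).2 (Ne.symm hne))

/-- A geodesic from `x` to `y` must cross `A`, and it stays in one halfspace of `B` because
halfspaces are convex. -/
theorem IsMedian.exists_adj_between (hG : G.IsMedian) {A B : G.Hyperplane} {x y : V}
    (hx : A.side x) (hy : ¬ A.side y) (hB : B.side x ↔ B.side y) :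
    ∃ (a b : V) (h : G.Adj a b), G.hyperplaneOf h = A ∧ A.side a ∧ ¬ A.side b ∧
      (B.side a ↔ B.side x) := by
  induction hn : G.dist x y generalizing x with
  | zero =>
    rw [hG.1.dist_eq_zero_iff] at hn
    subst hn
    exact absurd hx hy
  | succ n ih =>
    obtain ⟨x', hxx', hn'⟩ := hG.1.exists_adj_dist_eq hn
    have hb : G.dist x y = G.dist x x' + G.dist x' y := by
      rw [dist_eq_one_iff_adj.2 hxx']; omega
    have hBx := hG.between_iff.1 hb B hB
    by_cases hx' : A.side x'
    · obtain ⟨a, b, h, h1, h2, h3, h4⟩ := ih hx' (hBx.trans hB) hn'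
      exact ⟨a, b, h, h1, h2, h3, h4.trans hBx⟩
    · refine ⟨x, x', hxx', ?_, hx, hx', Iff.rfl⟩
      by_contra hne
      exact hx' (((hG.side_iff_of_adj hxx' A).2 (Ne.symm hne)).1 hx)

/-- Two hyperplanes are transverse if and only if their four quadrants are non-empty. -/
theorem IsMedian.transverse_iff (hG : G.IsMedian) {A B : G.Hyperplane} :
    G.Transverse A B ↔ ∀ s t : Prop, ∃ x, (A.side x ↔ s) ∧ (B.side x ↔ t) := by
  constructor
  · rintro ⟨o, a, b, ha, hb, hab, rfl, rfl, c, hc⟩ s t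
    have hne : G.hyperplaneOf ha ≠ G.hyperplaneOf hb :=
      fun h => hab (hG.eq_of_hyperplaneOf_eq ha hb h)
    have h1 := hG.side_iff_of_adj ha
    have h2 := hG.side_iff_of_adj hb
    have h3 := hG.side_iff_of_adj hc.2.1
    have hac : G.hyperplaneOf hc.2.1 = G.hyperplaneOf hb :=
      IsFourCycle.hyperplaneOf_eq (a := a) (b := c) (c := b) (d := o)
        ⟨hc.2.1, hc.2.2.1, hb.symm, ha, hab, hc.2.2.2.2.1.symm⟩ |>.trans (hyperplaneOf_symm hb)
    rw [hac] at h3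
    generalize G.hyperplaneOf ha = A at *
    generalize G.hyperplaneOf hb = B at *
    have a1 := h1 A
    have a2 := h1 B
    have b1 := h2 A
    have b2 := h2 B
    have c1 := h3 A
    have c2 := h3 B
    have hne' := hne.symm
    simp only [ne_eq, not_true_eq_false, iff_false, hne, hne', not_false_eq_true, iff_true]
      at a1 a2 b1 b2 c1 c2
    have flip : ∀ {p q r : Prop}, ¬ (p ↔ q) → ¬ (p ↔ r) → (q ↔ r) := by tauto
    by_cases hs : A.side o ↔ s <;> by_cases ht : B.side o ↔ t
    · exact ⟨o, hs, ht⟩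
    · exact ⟨b, b1.symm.trans hs, flip b2 ht⟩
    · exact ⟨a, flip a1 hs, a2.symm.trans ht⟩
    · exact ⟨c, c1.symm.trans (flip a1 hs), flip c2 (by rwa [← a2])⟩
  · intro h
    obtain ⟨x, hxA, hxB⟩ := h True True
    obtain ⟨y, hyA, hyB⟩ := h False True
    obtain ⟨z, hzA, hzB⟩ := h True False
    obtain ⟨w, hwA, hwB⟩ := h False False
    -- Two edges of `A`, one on each side of `B`, are joined by a ladder that `B` must cross.
    obtain ⟨a, b, hab, hA, haA, hbA, haB⟩ :=
      hG.exists_adj_between (A := A) (B := B) (x := x) (y := y)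
        (hxA.2 trivial) hyA.1 (hxB.trans hyB.symm)
    obtain ⟨c, d, hcd, hA', hcA, hdA, hcB⟩ :=
      hG.exists_adj_between (A := A) (B := B) (x := z) (y := w)
        (hzA.2 trivial) hwA.1 (hzB.trans hwB.symm)
    have e1 := hG.side_iff_side hab a c
    have e2 := hG.side_iff_side hab a d
    have e3 := hG.side_iff_side hcd c a
    have e4 := hG.side_iff_side hcd c b
    rw [hA] at e1 e2
    rw [hA'] at e3 e4
    have f1 := hG.dist_of_adj hab c
    have f2 := hG.dist_of_adj hab d
    have f3 := hG.dist_of_adj hcd a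
    have f4 := hG.dist_of_adj hcd b
    have g1 : G.dist a a < G.dist a b := by simp [dist_eq_one_iff_adj.2 hab]
    have g2 : G.dist c c < G.dist c d := by simp [dist_eq_one_iff_adj.2 hcd]
    have k1 := (e1.1 (iff_of_true haA hcA)).1 g1
    have k2 : ¬ G.dist d a < G.dist d b := fun h => hdA ((e2.2 (iff_of_true g1 h)).1 haA)
    have k3 := (e3.1 (iff_of_true hcA haA)).1 g2
    have k4 : ¬ G.dist b c < G.dist b d := fun h => hbA ((e4.2 (iff_of_true g2 h)).1 hcA)
    have s1 : G.dist c a = G.dist a c := G.dist_comm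
    have s2 : G.dist c b = G.dist b c := G.dist_comm
    have s3 : G.dist d a = G.dist a d := G.dist_comm
    have s4 : G.dist d b = G.dist b d := G.dist_comm
    rw [← hA]
    exact hG.transverse_of_ladder (n := G.dist a c) hab hcd rfl (by omega) (by omega) (by omega)
      (fun hac => hzB.1 (hcB.1 (hac.1 (haB.2 (hxB.2 trivial)))))

theorem IsMedian.not_transverse_self (hG : G.IsMedian) (A : G.Hyperplane) :
    ¬ G.Transverse A A := by
  intro h
  obtain ⟨x, h1, h2⟩ := hG.transverse_iff.1 h True False
  tauto

theorem Connected.eq_univ_of_adj_mem (hG : G.Connected) {S : Set V} {v : V} (hv : v ∈ S)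
    (h : ∀ x ∈ S, ∀ y, G.Adj x y → y ∈ S) : S = Set.univ := by
  refine Set.eq_univ_of_forall fun y => ?_
  obtain ⟨p⟩ := hG.preconnected v y
  induction p with
  | nil => exact hv
  | cons hadj _ ih => exact ih (h _ hv _ hadj)

end SimpleGraph

/-! ### The graph of orientations -/

namespace SimpleGraph

/-- The vertices of the completion: the choices of sides of the hyperplanes of `G` which differ
from those of a vertex at finitely many hyperplanes, and which are realized by a vertex on every
pair of hyperplanes not in `P`. -/
structure Orientation {V : Type*} (G : SimpleGraph V) (P : Set (Sym2 G.Hyperplane)) where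
  /-- The chosen side of each hyperplane. -/
  label : G.Hyperplane → Prop
  finite : ∀ x, (disagreement (G.sides x) label).Finite
  realized : ∀ A B : G.Hyperplane, s(A, B) ∉ P →
    ∃ x, (A.side x ↔ label A) ∧ (B.side x ↔ label B)

/-- Two orientations are adjacent if they differ at exactly one hyperplane. -/
def orientationGraph {V : Type*} (G : SimpleGraph V) (P : Set (Sym2 G.Hyperplane)) :
    SimpleGraph (G.Orientation P) where
  Adj σ τ := ∃ A, ∀ B, (σ.label B ↔ τ.label B) ↔ B ≠ A
  symm := ⟨fun σ τ ⟨A, h⟩ => ⟨A, fun B => by rw [← h B]; tauto⟩⟩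
  loopless := ⟨fun σ ⟨A, h⟩ => (h A).1 Iff.rfl rfl⟩

variable {V : Type*} {G : SimpleGraph V} {P : Set (Sym2 G.Hyperplane)}

theorem Orientation.eq_iff {σ τ : G.Orientation P} : σ = τ ↔ ∀ A, σ.label A ↔ τ.label A := by
  refine ⟨by rintro rfl A; rfl, fun h => ?_⟩
  cases σ; cases τ
  congr
  exact funext fun A => propext (h A)

theorem Orientation.finite_disagreement [Nonempty V] (σ τ : G.Orientation P) :
    (disagreement σ.label τ.label).Finite := by
  obtain ⟨x⟩ := ‹Nonempty V›
  refine ((σ.finite x).union (τ.finite x)).subset ?_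
  rw [disagreement_comm (G.sides x) σ.label]
  exact disagreement_subset_union _ _ _

/-- The orientation towards a vertex. -/
def IsMedian.principal (hG : G.IsMedian) (P : Set (Sym2 G.Hyperplane)) (x : V) :
    G.Orientation P :=
  ⟨G.sides x, fun y => hG.finite_disagreement y x, fun _ _ _ => ⟨x, Iff.rfl, Iff.rfl⟩⟩

/-- Flip a disagreement `A` whose `τ`-halfspace is maximal. If this conflicted with some `E`, then
`E` would be a disagreement as well and its `τ`-halfspace would contain that of `A`; by maximality
they coincide, so `E = A`. -/
theorem IsMedian.exists_flip (hG : G.IsMedian) (σ τ : G.Orientation P) (hne : σ ≠ τ) :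
    ∃ (ρ : G.Orientation P) (A : G.Hyperplane), A ∈ disagreement σ.label τ.label ∧
      (ρ.label A ↔ τ.label A) ∧ ∀ B, (σ.label B ↔ ρ.label B) ↔ B ≠ A := by
  have := hG.1.nonempty
  have hD : (disagreement σ.label τ.label).Nonempty := by
    by_contra h
    rw [Set.not_nonempty_iff_eq_empty] at h
    refine hne (Orientation.eq_iff.2 fun A => ?_)
    by_contra hA
    exact Set.notMem_empty A (h ▸ hA)
  obtain ⟨A, hA, hmax⟩ := (σ.finite_disagreement τ).exists_maximalFor
    (fun A : G.Hyperplane => {x | A.side x ↔ τ.label A}) _ hD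
  have key : ∀ E, s(A, E) ∉ P → E ≠ A → ∃ x, (A.side x ↔ τ.label A) ∧ (E.side x ↔ σ.label E) := by
    intro E hE hEA
    by_cases hED : σ.label E ↔ τ.label E
    · rw [hED]; exact τ.realized A E hE
    · by_contra hno
      have h1 : ∀ x, (A.side x ↔ τ.label A) → (E.side x ↔ τ.label E) := by
        intro x hx
        by_contra hx'
        exact hno ⟨x, hx, by tauto⟩
      have h2 : ∀ x, (E.side x ↔ τ.label E) → (A.side x ↔ τ.label A) := fun x hx => hmax hED h1 hx
      apply hEA
      refine hG.hyperplane_ext fun x y hxy => ?_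
      have hx : (A.side x ↔ τ.label A) ↔ (E.side x ↔ τ.label E) := ⟨h1 x, h2 x⟩
      have hy : (A.side y ↔ τ.label A) ↔ (E.side y ↔ τ.label E) := ⟨h1 y, h2 y⟩
      rw [hxy] at hx
      have hxy' := hx.trans hy.symm
      clear h1 h2 hmax hx hy
      tauto
  have hself : ∀ E, E ≠ A → ((E = A ∧ τ.label A ∨ E ≠ A ∧ σ.label E) ↔ σ.label E) := by
    intro E hE; simp [hE]
  have hA' : (A = A ∧ τ.label A ∨ A ≠ A ∧ σ.label A) ↔ τ.label A := by simp
  refine ⟨⟨fun B => B = A ∧ τ.label A ∨ B ≠ A ∧ σ.label B, fun x => ?_, fun C E hCE => ?_⟩, A, hA, hA',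
    fun B => ?_⟩
  · refine ((σ.finite x).insert A).subset fun B hB => ?_
    by_cases h : B = A
    · exact Or.inl h
    · right
      rw [mem_disagreement] at hB ⊢
      rwa [hself B h] at hB
  · by_cases hC : C = A <;> by_cases hE : E = A
    · subst hC hE
      obtain ⟨x, hx⟩ := hG.exists_side_iff E (τ.label E)
      exact ⟨x, hx.trans hA'.symm, hx.trans hA'.symm⟩
    · subst hC
      obtain ⟨x, hx, hx'⟩ := key E hCE hE
      exact ⟨x, hx.trans hA'.symm, hx'.trans (hself E hE).symm⟩
    · subst hE
      obtain ⟨x, hx, hx'⟩ := key C (by rwa [Sym2.eq_swap]) hC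
      exact ⟨x, hx'.trans (hself C hC).symm, hx.trans hA'.symm⟩
    · obtain ⟨x, hx, hx'⟩ := σ.realized C E hCE
      exact ⟨x, hx.trans (hself C hC).symm, hx'.trans (hself E hE).symm⟩
  · by_cases h : B = A
    · subst h
      simpa [mem_disagreement] using hA
    · simp [h]

theorem IsMedian.exists_walk_orientationGraph (hG : G.IsMedian) (σ τ : G.Orientation P) :
    ∃ p : (G.orientationGraph P).Walk σ τ, p.length = (disagreement σ.label τ.label).ncard := by
  have := hG.1.nonempty
  induction hn : (disagreement σ.label τ.label).ncard generalizing σ with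
  | zero =>
    rw [Set.ncard_eq_zero (σ.finite_disagreement τ)] at hn
    have : σ = τ := by
      refine Orientation.eq_iff.2 fun A => ?_
      by_contra hA
      exact Set.notMem_empty A (hn ▸ hA)
    subst this
    exact ⟨Walk.nil, rfl⟩
  | succ n ih =>
    have hne : σ ≠ τ := by
      rintro rfl
      simp [disagreement] at hn
    obtain ⟨ρ, A, hA, hρA, hρ⟩ := hG.exists_flip σ τ hne
    have hcard : (disagreement σ.label τ.label) = insert A (disagreement ρ.label τ.label) := by
      ext B
      have := hρ B
      simp only [mem_disagreement, Set.mem_insert_iff] at hA ⊢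
      by_cases h : B = A
      · subst h; tauto
      · tauto
    rw [hcard, Set.ncard_insert_of_notMem (by simpa [mem_disagreement] using hρA)
      (ρ.finite_disagreement τ)] at hn
    obtain ⟨p, hp⟩ := ih ρ (by omega)
    have hadj : (G.orientationGraph P).Adj σ ρ := ⟨A, hρ⟩
    exact ⟨Walk.cons hadj p, by simp [hp]⟩

theorem ncard_disagreement_le_length [Nonempty V] {σ τ : G.Orientation P}
    (p : (G.orientationGraph P).Walk σ τ) : (disagreement σ.label τ.label).ncard ≤ p.length := by
  induction p with
  | nil => simp [disagreement]
  | @cons σ ρ τ h p ih =>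
    rw [Walk.length_cons]
    obtain ⟨A, hA⟩ := h
    have : disagreement σ.label τ.label ⊆ insert A (disagreement ρ.label τ.label) := by
      intro B hB
      have := hA B
      simp only [mem_disagreement, Set.mem_insert_iff] at hB ⊢
      by_cases h : B = A
      · exact Or.inl h
      · right; tauto
    have h1 := Set.ncard_le_ncard this ((ρ.finite_disagreement τ).insert A)
    have h2 := Set.ncard_insert_le A (disagreement ρ.label τ.label)
    omega

theorem IsMedian.connected_orientationGraph (hG : G.IsMedian) :
    (G.orientationGraph P).Connected := by
  obtain ⟨x⟩ := hG.1.nonempty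
  have : Nonempty (G.Orientation P) := ⟨hG.principal P x⟩
  exact ⟨fun σ τ => ⟨(hG.exists_walk_orientationGraph σ τ).choose⟩⟩

theorem IsMedian.dist_orientationGraph (hG : G.IsMedian) (σ τ : G.Orientation P) :
    (G.orientationGraph P).dist σ τ = (disagreement σ.label τ.label).ncard := by
  have := hG.1.nonempty
  obtain ⟨p, hp⟩ := hG.exists_walk_orientationGraph σ τ
  obtain ⟨q, hq⟩ :=
    (hG.connected_orientationGraph (P := P)).exists_walk_length_eq_dist σ τ
  exact le_antisymm (hp ▸ dist_le p) (hq ▸ ncard_disagreement_le_length q)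

theorem IsMedian.between_orientationGraph (hG : G.IsMedian) {σ μ τ : G.Orientation P} :
    (G.orientationGraph P).dist σ τ =
        (G.orientationGraph P).dist σ μ + (G.orientationGraph P).dist μ τ ↔
      ∀ A, (σ.label A ↔ τ.label A) → (μ.label A ↔ σ.label A) := by
  have := hG.1.nonempty
  simp only [hG.dist_orientationGraph]
  exact ncard_disagreement_eq_add_iff (σ.finite_disagreement μ) (μ.finite_disagreement τ)

theorem majority_iff {p q r m : Prop} (h₁ : (p ↔ q) → (m ↔ p)) (h₂ : (q ↔ r) → (m ↔ q))
    (h₃ : (p ↔ r) → (m ↔ p)) : m ↔ (p ∧ q) ∨ (q ∧ r) ∨ (p ∧ r) := by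
  by_cases p <;> by_cases q <;> by_cases r <;> simp_all

/-- The median is the majority vote. On a pair off `P` it is realized by the median of three
vertices realizing `σ`, `τ`, `ρ`. -/
theorem IsMedian.isMedian_orientationGraph (hG : G.IsMedian) :
    (G.orientationGraph P).IsMedian := by
  refine ⟨hG.connected_orientationGraph, fun σ τ ρ => ?_⟩
  simp only [hG.between_orientationGraph]
  refine ⟨⟨fun A => (σ.label A ∧ τ.label A) ∨ (τ.label A ∧ ρ.label A) ∨ (σ.label A ∧ ρ.label A), fun x => ?_,
    fun A B hAB => ?_⟩, ⟨fun A => ?_, fun A => ?_, fun A => ?_⟩, ?_⟩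
  · refine ((σ.finite x).union (τ.finite x)).subset fun A => ?_
    simp only [mem_disagreement, Set.mem_union]; tauto
  · obtain ⟨x, hx, hx'⟩ := σ.realized A B hAB
    obtain ⟨y, hy, hy'⟩ := τ.realized A B hAB
    obtain ⟨z, hz, hz'⟩ := ρ.realized A B hAB
    obtain ⟨m, hm⟩ := hG.exists_majority x y z
    refine ⟨m, ?_, ?_⟩
    · have := majority_iff (hm A).1 (hm A).2.1 (hm A).2.2
      rwa [hx, hy, hz] at this
    · have := majority_iff (hm B).1 (hm B).2.1 (hm B).2.2
      rwa [hx', hy', hz'] at this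
  · dsimp only; clear hG; tauto
  · dsimp only; clear hG; tauto
  · dsimp only; clear hG; tauto
  · rintro μ ⟨h1, h2, h3⟩
    refine Orientation.eq_iff.2 fun A => ?_
    exact majority_iff (h1 A) (h2 A) (h3 A)

/-- Two edges of the orientation graph are parallel if and only if they flip the same
hyperplane. -/
theorem IsMedian.hyperplaneOf_orientationGraph_eq_iff (hG : G.IsMedian)
    {σ τ σ' τ' : G.Orientation P} (h : (G.orientationGraph P).Adj σ τ)
    (h' : (G.orientationGraph P).Adj σ' τ') {A A' : G.Hyperplane}
    (hA : ∀ B, (σ.label B ↔ τ.label B) ↔ B ≠ A) (hA' : ∀ B, (σ'.label B ↔ τ'.label B) ↔ B ≠ A') :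
    (G.orientationGraph P).hyperplaneOf h = (G.orientationGraph P).hyperplaneOf h' ↔ A = A' := by
  have hZ := hG.isMedian_orientationGraph (P := P)
  -- The halfspaces of the edge `στ` are the two values of the label at `A`, so its hyperplane is
  -- crossed exactly by the edges that flip `A`.
  have hcl : ∀ ρ : G.Orientation P, (G.orientationGraph P).dist ρ σ <
      (G.orientationGraph P).dist ρ τ ↔ (ρ.label A ↔ σ.label A) := by
    intro ρ
    have b1 := hG.between_orientationGraph (σ := ρ) (μ := σ) (τ := τ)
    have b2 := hG.between_orientationGraph (σ := ρ) (μ := τ) (τ := σ)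
    rw [dist_eq_one_iff_adj.2 h] at b1
    rw [dist_eq_one_iff_adj.2 h.symm] at b2
    have hAA := hA A
    constructor
    · intro hlt
      by_contra hn
      have : (G.orientationGraph P).dist ρ σ = (G.orientationGraph P).dist ρ τ + 1 := by
        refine b2.2 fun B hB => ?_
        by_cases hBA : B = A
        · subst hBA; exact absurd hB hn
        · exact ((hA B).2 hBA).symm.trans hB.symm
      omega
    · intro hiff
      have : (G.orientationGraph P).dist ρ τ = (G.orientationGraph P).dist ρ σ + 1 := by
        refine b1.2 fun B hB => ?_
        by_cases hBA : B = A
        · subst hBA; exact hiff.symm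
        · exact ((hA B).2 hBA).trans hB.symm
      omega
  have h1 := hZ.side_iff_of_adj h' ((G.orientationGraph P).hyperplaneOf h)
  rw [hZ.side_iff_side, hcl, hcl] at h1
  have h2 := hA' A
  have h3 : ((σ'.label A ↔ σ.label A) ↔ (τ'.label A ↔ σ.label A)) ↔ (σ'.label A ↔ τ'.label A) := by tauto
  rw [h3, h2] at h1
  exact not_iff_not.1 h1.symm

/-- The embedding of a median graph into its orientation graph. -/
def IsMedian.principalEmbedding (hG : G.IsMedian) (P : Set (Sym2 G.Hyperplane)) :
    G ↪g G.orientationGraph P where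
  toFun := hG.principal P
  inj' x y h := hG.eq_of_sides (Orientation.eq_iff.1 h)
  map_rel_iff' {x y} := by
    constructor
    · rintro ⟨A, hA⟩
      rw [← dist_eq_one_iff_adj, ← hG.ncard_disagreement, Set.ncard_eq_one]
      refine ⟨A, Set.ext fun B => ?_⟩
      have := hA B
      change ¬ (G.sides x B ↔ G.sides y B) ↔ B = A
      change (G.sides x B ↔ G.sides y B) ↔ B ≠ A at this
      tauto
    · exact fun h => ⟨G.hyperplaneOf h, hG.side_iff_of_adj h⟩

theorem IsMedian.isIsometric_principalEmbedding (hG : G.IsMedian) :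
    IsIsometric (hG.principalEmbedding P) := fun x y => by
  rw [hG.dist_orientationGraph, ← hG.ncard_disagreement]; rfl

theorem IsMedian.image_principalEmbedding_eq_iff (hG : G.IsMedian) (B : G.Hyperplane)
    {σ τ : G.Orientation P} (h : (G.orientationGraph P).Adj σ τ) {A : G.Hyperplane}
    (hA : ∀ B, (σ.label B ↔ τ.label B) ↔ B ≠ A) :
    B.image (hG.principalEmbedding P).toHom (hG.principalEmbedding P).parallelPreserving =
      (G.orientationGraph P).hyperplaneOf h ↔ B = A := by
  obtain ⟨x, y, hxy, rfl⟩ := B.exists_adj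
  exact hG.hyperplaneOf_orientationGraph_eq_iff ((hG.principalEmbedding P).map_adj_iff.2 hxy) h
    (hG.side_iff_of_adj hxy) hA

/-- If `τ` is `σ` flipped at `A`, then `τ` lies between `σ` and any vertex of `G` on the side
`τ.label A`; convexity therefore spreads along edges. -/
theorem IsMedian.geodesicConvexHull_principalEmbedding (hG : G.IsMedian) :
    (G.orientationGraph P).geodesicConvexHull (Set.range (hG.principalEmbedding P)) =
      Set.univ := by
  obtain ⟨x₀⟩ := hG.1.nonempty
  rw [geodesicConvexHull, Set.sInter_eq_univ]
  rintro C ⟨hC, hconv⟩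
  refine (hG.connected_orientationGraph (P := P)).eq_univ_of_adj_mem (hC ⟨x₀, rfl⟩) ?_
  rintro σ hσ τ ⟨A, hA⟩
  obtain ⟨x, hx⟩ := hG.exists_side_iff A (τ.label A)
  refine hconv σ hσ _ (hC ⟨x, rfl⟩) τ (hG.between_orientationGraph.2 fun B hB => ?_).symm
  by_cases hBA : B = A
  · subst hBA
    exact absurd (hB.trans hx) (fun h => (hA B).1 h rfl)
  · exact ((hA B).2 hBA).symm

end SimpleGraph

/-! ### Transverse hyperplanes of the completion -/

namespace SimpleGraph

section

variable {V : Type*} {G : SimpleGraph V} {P : Set (Sym2 G.Hyperplane)}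

theorem IsMedian.transverse_image_of_tangent (hG : G.IsMedian) {A B : G.Hyperplane}
    (hAB : s(A, B) ∈ P) (ht : G.Tangent A B) :
    (G.orientationGraph P).Transverse
      (A.image (hG.principalEmbedding P).toHom (hG.principalEmbedding P).parallelPreserving)
      (B.image (hG.principalEmbedding P).toHom (hG.principalEmbedding P).parallelPreserving) := by
  obtain ⟨o, a, b, ha, hb, hab, rfl, rfl, -⟩ := ht
  have hne : G.hyperplaneOf ha ≠ G.hyperplaneOf hb :=
    fun h => hab (hG.eq_of_hyperplaneOf_eq ha hb h)
  have h1 := hG.side_iff_of_adj ha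
  have h2 := hG.side_iff_of_adj hb
  set ι := hG.principalEmbedding P
  -- The missing corner: `o` flipped at both hyperplanes. Every pair of labels other than this pair
  -- is already realized by `a` or by `b`, and this pair is in `P`.
  let ρ : G.Orientation P :=
    { label := fun K => (K = G.hyperplaneOf ha ∧ K.side a) ∨ (K ≠ G.hyperplaneOf ha ∧ K.side b)
      finite := fun x => by
        refine ((hG.finite_disagreement x a).union (hG.finite_disagreement x b)).subset ?_
        intro K
        simp only [mem_disagreement, Set.mem_union, sides]
        by_cases hK : K = G.hyperplaneOf ha
        · simp only [hK, true_and, ne_eq, not_true_eq_false, false_and, or_false]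
          exact Or.inl
        · simp only [hK, false_and, ne_eq, not_false_eq_true, true_and, false_or]
          exact Or.inr
      realized := fun C D hCD => by
        by_cases hC : C = G.hyperplaneOf ha <;> by_cases hD : D = G.hyperplaneOf ha
        · exact ⟨a, by simp [hC], by simp [hD]⟩
        · refine ⟨a, by simp [hC], ?_⟩
          have hD' : D ≠ G.hyperplaneOf hb := by
            rintro rfl; subst hC; exact hCD hAB
          simp only [hD, false_and, ne_eq, not_false_eq_true, true_and, false_or]
          exact ((h1 D).2 hD).symm.trans ((h2 D).2 hD')
        · refine ⟨a, ?_, by simp [hD]⟩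
          have hC' : C ≠ G.hyperplaneOf hb := by
            rintro rfl; subst hD; rw [Sym2.eq_swap] at hCD; exact hCD hAB
          simp only [hC, false_and, ne_eq, not_false_eq_true, true_and, false_or]
          exact ((h1 C).2 hC).symm.trans ((h2 C).2 hC')
        · exact ⟨b, by simp [hC], by simp [hD]⟩ }
  have hρ : ∀ K, ρ.label K ↔
      (K = G.hyperplaneOf ha ∧ K.side a) ∨ (K ≠ G.hyperplaneOf ha ∧ K.side b) :=
    fun _ => Iff.rfl
  have haρ : (G.orientationGraph P).Adj (ι a) ρ := by
    refine ⟨G.hyperplaneOf hb, fun K => ?_⟩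
    change (K.side a ↔ ρ.label K) ↔ _
    rw [hρ]
    by_cases hK : K = G.hyperplaneOf ha
    · simp [hK, hne]
    · simp only [hK, false_and, ne_eq, not_false_eq_true, true_and, false_or]
      rw [← (h1 K).2 hK]
      exact h2 K
  have hρb : (G.orientationGraph P).Adj ρ (ι b) := by
    refine ⟨G.hyperplaneOf ha, fun K => ?_⟩
    change (ρ.label K ↔ K.side b) ↔ _
    rw [hρ]
    by_cases hK : K = G.hyperplaneOf ha
    · subst hK
      have e1 := h1 (G.hyperplaneOf ha)
      have e2 := (h2 (G.hyperplaneOf ha)).2 hne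
      simp only [true_and, ne_eq, not_true_eq_false, false_and, or_false, iff_false] at e1 ⊢
      rwa [← e2, iff_comm]
    · simp [hK]
  refine ⟨ι o, ι a, ι b, ι.map_adj_iff.2 ha, ι.map_adj_iff.2 hb, ι.injective.ne hab, rfl, rfl, ρ,
    ι.map_adj_iff.2 ha, haρ, hρb, (ι.map_adj_iff.2 hb).symm, ?_, ι.injective.ne hab⟩
  intro h
  have e1 := Orientation.eq_iff.1 h (G.hyperplaneOf ha)
  change (G.hyperplaneOf ha).side o ↔ _ at e1
  rw [hρ] at e1
  simp only [true_and, ne_eq, not_true_eq_false, false_and, or_false] at e1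
  exact (h1 _).1 e1 rfl

theorem Transverse.image {W : Type*} {H : SimpleGraph W} (ι : G ↪g H) {A B : G.Hyperplane}
    (h : G.Transverse A B) :
    H.Transverse (A.image ι.toHom ι.parallelPreserving)
      (B.image ι.toHom ι.parallelPreserving) := by
  obtain ⟨o, a, b, ha, hb, hab, rfl, rfl, c, h1, h2, h3, h4, h5, h6⟩ := h
  exact ⟨ι o, ι a, ι b, ι.map_adj_iff.2 ha, ι.map_adj_iff.2 hb, ι.injective.ne hab, rfl, rfl, ι c,
    ι.map_adj_iff.2 h1, ι.map_adj_iff.2 h2, ι.map_adj_iff.2 h3, ι.map_adj_iff.2 h4,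
    ι.injective.ne h5, ι.injective.ne h6⟩

theorem IsMedian.isHullWithTransversality_principalEmbedding (hG : G.IsMedian)
    (hP : ∀ A B : G.Hyperplane, s(A, B) ∈ P → G.Tangent A B) :
    IsHullWithTransversality P (hG.principalEmbedding P) where
  hull := hG.geodesicConvexHull_principalEmbedding
  transverse_iff J K := by
    constructor
    · rintro ⟨o, a, b, ha, hb, hab, rfl, rfl, c, hc⟩
      have hoa := ha
      have hob := hb
      obtain ⟨A, hA⟩ := ha
      obtain ⟨B, hB⟩ := hb
      refine ⟨A, B, (hG.image_principalEmbedding_eq_iff _ hoa hA).2 rfl,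
        (hG.image_principalEmbedding_eq_iff _ hob hB).2 rfl, ?_⟩
      by_contra hno
      rw [not_or] at hno
      -- The corners of the square carry all four pairs of labels at the two hyperplanes. Off `P`
      -- each is realized in `G`, so the four quadrants there are nonempty.
      refine hno.1 (hG.transverse_iff.2 fun s t => ?_)
      have hZ := hG.isMedian_orientationGraph (P := P)
      have hne : A ≠ B := by
        intro h
        exact hab (hZ.eq_of_hyperplaneOf_eq hoa hob
          ((hG.hyperplaneOf_orientationGraph_eq_iff hoa hob hA hB).2 h))
      obtain ⟨C, hC⟩ := hc.2.1
      have hCB : C = B := by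
        refine (hG.hyperplaneOf_orientationGraph_eq_iff hc.2.1 hob.symm hC
          (fun K => by rw [← hB K]; tauto)).1 ?_
        exact IsFourCycle.hyperplaneOf_eq (a := a) (b := c) (c := b) (d := o)
          ⟨hc.2.1, hc.2.2.1, hob.symm, hoa, hab, hc.2.2.2.2.1.symm⟩
      subst hCB
      have a1 := hA A
      have a2 := (hA C).2 hne.symm
      have b1 := hB C
      have b2 := (hB A).2 hne
      have c1 := hC C
      have c2 := (hC A).2 hne
      simp only [ne_eq, not_true_eq_false, iff_false] at a1 b1 c1
      have flip : ∀ {p q r : Prop}, ¬ (p ↔ q) → ¬ (p ↔ r) → (q ↔ r) := by tauto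
      have key : ∀ σ : G.Orientation P, (σ.label A ↔ s) → (σ.label C ↔ t) →
          ∃ x, (A.side x ↔ s) ∧ (C.side x ↔ t) := by
        intro σ h h'
        obtain ⟨x, hx, hx'⟩ := σ.realized A C hno.2
        exact ⟨x, hx.trans h, hx'.trans h'⟩
      by_cases hs : o.label A ↔ s <;> by_cases ht : o.label C ↔ t
      · exact key o hs ht
      · exact key b (b2.symm.trans hs) (flip b1 ht)
      · exact key a (flip a1 hs) (a2.symm.trans ht)
      · exact key c (c2.symm.trans (flip a1 hs)) (flip c1 (by rwa [← a2]))
    · rintro ⟨A, B, rfl, rfl, h | h⟩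
      · exact h.image _
      · exact hG.transverse_image_of_tangent h (hP A B h)

end

/-! ### The universal property -/

section

variable {V U : Type*} {X : SimpleGraph V} {Y : SimpleGraph U}

/-- A geodesic from `x` to `y` crosses only hyperplanes separating them; none maps to `K`, so its
image never crosses `K`. -/
theorem IsMedian.side_image_iff (hX : X.IsMedian) (hY : Y.IsMedian) {ψ : X →g Y}
    (hψ : ParallelPreserving ψ) {K : Y.Hyperplane} {x y : V}
    (h : ∀ A : X.Hyperplane, A.image ψ hψ = K → (A.side x ↔ A.side y)) :
    K.side (ψ x) ↔ K.side (ψ y) := by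
  induction hn : X.dist x y generalizing x with
  | zero =>
    rw [hX.1.dist_eq_zero_iff] at hn
    rw [hn]
  | succ n ih =>
    obtain ⟨x', hx, hn'⟩ := hX.1.exists_adj_dist_eq hn
    have hb : X.dist x y = X.dist x x' + X.dist x' y := by
      rw [dist_eq_one_iff_adj.2 hx]; omega
    rw [← ih (fun A hA => (hX.between_iff.1 hb A (h A hA)).trans (h A hA)) hn',
      hY.side_iff_of_adj (ψ.map_adj hx)]
    rintro rfl
    exact (hX.side_iff_of_adj hx _).1 (hX.between_iff.1 hb _ (h (X.hyperplaneOf hx) rfl)).symm rfl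

/-- Among the hyperplanes with the same image as `B`, a geodesic from `x` to `y` crosses only `B`,
and only once; its image thus crosses that hyperplane exactly once. -/
theorem IsMedian.not_side_image_iff (hX : X.IsMedian) (hY : Y.IsMedian) {ψ : X →g Y}
    (hψ : ParallelPreserving ψ) {B : X.Hyperplane} {x y : V}
    (h : ∀ A : X.Hyperplane, A.image ψ hψ = B.image ψ hψ → ((A.side x ↔ A.side y) ↔ A ≠ B)) :
    ¬ ((B.image ψ hψ).side (ψ x) ↔ (B.image ψ hψ).side (ψ y)) := by
  induction hn : X.dist x y generalizing x with
  | zero =>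
    rw [hX.1.dist_eq_zero_iff] at hn
    subst hn
    exact absurd rfl ((h B rfl).1 Iff.rfl)
  | succ n ih =>
    obtain ⟨x', hx, hn'⟩ := hX.1.exists_adj_dist_eq hn
    have hb : X.dist x y = X.dist x x' + X.dist x' y := by
      rw [dist_eq_one_iff_adj.2 hx]; omega
    by_cases hK : B.image ψ hψ = Y.hyperplaneOf (ψ.map_adj hx)
    · have hB : X.hyperplaneOf hx = B := by
        by_contra hne
        have := (h (X.hyperplaneOf hx) hK.symm).2 hne
        exact (hX.side_iff_of_adj hx _).1 (hX.between_iff.1 hb _ this).symm rfl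
      rw [← hX.side_image_iff hY hψ (x := x') (y := y), hY.side_iff_of_adj (ψ.map_adj hx)]
      · exact not_not.2 hK
      · intro A hA
        have h1 := h A hA
        have h2 := hX.side_iff_of_adj hx A
        rw [hB] at h2
        by_cases hAB : A = B
        · simp only [hAB, ne_eq, not_true_eq_false, iff_false] at h1 h2 ⊢
          clear hb ih
          tauto
        · exact (h2.2 hAB).symm.trans (h1.2 hAB)
    · rw [(hY.side_iff_of_adj (ψ.map_adj hx) _).2 hK]
      refine ih (fun A hA => ?_) hn'
      rw [← h A hA, ← (hX.side_iff_of_adj hx A).2]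
      rintro rfl
      exact hK hA.symm

variable {P : Set (Sym2 X.Hyperplane)}

theorem IsMedian.exists_forall_side_iff_label (hX : X.IsMedian) (F : Set X.Hyperplane)
    (σ : X.Orientation P) (hF : ∀ A ∈ F, ∀ B ∈ F, s(A, B) ∉ P) :
    ∃ x, ∀ A ∈ F, A.side x ↔ σ.label A := by
  obtain ⟨x₀⟩ := hX.1.nonempty
  exact hX.exists_forall_side_iff F σ.label x₀ ((σ.finite x₀).subset fun A hA => hA.2)
    fun A hA B hB => σ.realized A B (hF A hA B hB)

/-- The side of `K` is read off at any vertex agreeing with `σ` on the fibre of `K`;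
`side_image_iff` makes this independent of the vertex. Helly in `Y` then assembles the sides. -/
theorem IsMedian.exists_vertex_of_orientation (hX : X.IsMedian) (hY : Y.IsMedian) {ψ : X →g Y}
    (hψ : ParallelPreserving ψ)
    (hP : ∀ A B : X.Hyperplane, s(A, B) ∈ P → Y.Transverse (A.image ψ hψ) (B.image ψ hψ))
    (σ : X.Orientation P) :
    ∃ y : U, ∀ (K : Y.Hyperplane) (x : V),
      (∀ A : X.Hyperplane, A.image ψ hψ = K → (A.side x ↔ σ.label A)) →
        (K.side y ↔ K.side (ψ x)) := by
  obtain ⟨x₀⟩ := hX.1.nonempty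
  let o : Y.Hyperplane → Prop := fun K => ∃ x,
    (∀ A : X.Hyperplane, A.image ψ hψ = K → (A.side x ↔ σ.label A)) ∧ K.side (ψ x)
  have ho : ∀ (K : Y.Hyperplane) (x : V),
      (∀ A : X.Hyperplane, A.image ψ hψ = K → (A.side x ↔ σ.label A)) →
        (o K ↔ K.side (ψ x)) := by
    intro K x hx
    refine ⟨?_, fun h => ⟨x, hx, h⟩⟩
    rintro ⟨x', hx', h⟩
    exact (hX.side_image_iff hY hψ fun A hA => (hx' A hA).trans (hx A hA).symm).1 h
  have hfin : {K ∈ Set.univ | ¬ (K.side (ψ x₀) ↔ o K)}.Finite := by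
    refine ((σ.finite x₀).image (Hyperplane.image ψ hψ)).subset ?_
    rintro K ⟨-, hK⟩
    by_contra hn
    refine hK (ho K x₀ fun A hA => ?_).symm
    by_contra hA'
    exact hn ⟨A, hA', hA⟩
  have hpair : ∀ K ∈ Set.univ, ∀ L ∈ Set.univ, ∃ y, (K.side y ↔ o K) ∧ (L.side y ↔ o L) := by
    intro K _ L _
    -- With no pair of `P` in the two fibres, Helly in `X` gives one vertex serving both. Otherwise
    -- `K` and `L` are transverse in `Y`, and every quadrant is nonempty.
    by_cases hF : ∀ A ∈ {A : X.Hyperplane | A.image ψ hψ = K ∨ A.image ψ hψ = L},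
        ∀ B ∈ {A : X.Hyperplane | A.image ψ hψ = K ∨ A.image ψ hψ = L}, s(A, B) ∉ P
    · obtain ⟨x, hx⟩ := hX.exists_forall_side_iff_label _ σ hF
      exact ⟨ψ x, (ho K x fun A hA => hx A (Or.inl hA)).symm,
        (ho L x fun A hA => hx A (Or.inr hA)).symm⟩
    · push Not at hF
      obtain ⟨A, hA, B, hB, hAB⟩ := hF
      have ht := hP A B hAB
      rcases hA with rfl | rfl <;> rcases hB with hB | hB
      · exact absurd (hB ▸ ht) (hY.not_transverse_self _)
      · subst hB; exact hY.transverse_iff.1 ht _ _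
      · subst hB
        obtain ⟨y, h1, h2⟩ := hY.transverse_iff.1 ht (o (A.image ψ hψ)) (o (B.image ψ hψ))
        exact ⟨y, h2, h1⟩
      · exact absurd (hB ▸ ht) (hY.not_transverse_self _)
  obtain ⟨y, hy⟩ := hY.exists_forall_side_iff Set.univ o (ψ x₀) hfin hpair
  exact ⟨y, fun K x hx => (hy K trivial).trans (ho K x hx)⟩

theorem IsMedian.existsUnique_extension (hX : X.IsMedian) (hY : Y.IsMedian) {ψ : X →g Y}
    (hψ : ParallelPreserving ψ)
    (hP : ∀ A B : X.Hyperplane, s(A, B) ∈ P → Y.Transverse (A.image ψ hψ) (B.image ψ hψ)) :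
    ∃! ξ : X.orientationGraph P →g Y, ParallelPreserving ξ ∧
      ∀ x : V, ξ (hX.principalEmbedding P x) = ψ x := by
  choose f hf using hX.exists_vertex_of_orientation hY hψ hP
  have hfib : ∀ (σ : X.Orientation P) (K : Y.Hyperplane),
      ∃ x, ∀ A : X.Hyperplane, A.image ψ hψ = K → (A.side x ↔ σ.label A) := by
    intro σ K
    refine hX.exists_forall_side_iff_label {A | A.image ψ hψ = K} σ fun A hA B hB hAB => ?_
    have := hP A B hAB
    rw [show A.image ψ hψ = K from hA, show B.image ψ hψ = K from hB] at this
    exact hY.not_transverse_self K this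
  -- Witnesses for `σ` and `τ` on the fibre of `K` are separated within that fibre at most by `A`.
  have hside : ∀ {σ τ : X.Orientation P} {A : X.Hyperplane},
      (∀ B, (σ.label B ↔ τ.label B) ↔ B ≠ A) → ∀ K : Y.Hyperplane,
        (K.side (f σ) ↔ K.side (f τ)) ↔ K ≠ A.image ψ hψ := by
    intro σ τ A hA K
    obtain ⟨x, hx⟩ := hfib σ K
    obtain ⟨y, hy⟩ := hfib τ K
    rw [hf σ K x hx, hf τ K y hy]
    constructor
    · rintro h rfl
      refine hX.not_side_image_iff hY hψ (fun B hB => ?_) h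
      rw [hx B hB, hy B hB, hA B]
    · intro hne
      refine hX.side_image_iff hY hψ fun B hB => ?_
      rw [hx B hB, hy B hB, hA B]
      rintro rfl
      exact hne hB.symm
  have hadj : ∀ {σ τ : X.Orientation P}, (X.orientationGraph P).Adj σ τ →
      Y.Adj (f σ) (f τ) := by
    rintro σ τ ⟨A, hA⟩
    rw [← dist_eq_one_iff_adj, ← hY.ncard_disagreement, Set.ncard_eq_one]
    refine ⟨A.image ψ hψ, Set.ext fun K => ?_⟩
    rw [mem_disagreement, Set.mem_singleton_iff]
    exact (hside hA K).not.trans not_not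
  let ξ : X.orientationGraph P →g Y := ⟨f, hadj⟩
  have hlabel : ∀ {σ τ : X.Orientation P} (h : (X.orientationGraph P).Adj σ τ)
      {A : X.Hyperplane}, (∀ B, (σ.label B ↔ τ.label B) ↔ B ≠ A) →
      Y.hyperplaneOf (hadj h) = A.image ψ hψ := by
    intro σ τ h A hA
    by_contra hne
    exact (hY.side_iff_of_adj (hadj h) _).1 ((hside hA _).2 hne) rfl
  have hpar : ParallelPreserving ξ := by
    rintro ⟨e, he⟩ ⟨e', he'⟩ h
    induction e using Sym2.ind with | _ σ τ =>
    induction e' using Sym2.ind with | _ σ' τ' =>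
    have h1 : (X.orientationGraph P).Adj σ τ := he
    have h2 : (X.orientationGraph P).Adj σ' τ' := he'
    have h1' := h1
    have h2' := h2
    obtain ⟨A, hA⟩ := h1'
    obtain ⟨B, hB⟩ := h2'
    have hAB := (hX.hyperplaneOf_orientationGraph_eq_iff h1 h2 hA hB).1
      (Quotient.sound (s := (X.orientationGraph P).parallelSetoid) h)
    exact Quotient.exact (s := Y.parallelSetoid)
      ((hlabel h1 hA).trans ((hAB ▸ rfl : A.image ψ hψ = B.image ψ hψ).trans (hlabel h2 hB).symm))
  refine ⟨ξ, ⟨hpar, fun x => ?_⟩, ?_⟩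
  · exact hY.eq_of_sides fun K => hf _ K x fun A _ => Iff.rfl
  · rintro ξ' ⟨hpar', hξ'⟩
    obtain ⟨x₀⟩ := hX.1.nonempty
    -- An edge flipping `A` is parallel to the image of an edge of `X`, so every extension sends it
    -- into `ψ(A)`. An edge at a given vertex is determined by its hyperplane, hence agreement
    -- spreads from `x₀`.
    have hlabel' : ∀ {σ τ : X.Orientation P} (h : (X.orientationGraph P).Adj σ τ)
        {A : X.Hyperplane}, (∀ B, (σ.label B ↔ τ.label B) ↔ B ≠ A) →
        Y.hyperplaneOf (ξ'.map_adj h) = A.image ψ hψ := by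
      intro σ τ h A hA
      obtain ⟨x, y, hxy, rfl⟩ := A.exists_adj
      have hι := (hX.principalEmbedding P).map_adj_iff.2 hxy
      have := (hX.hyperplaneOf_orientationGraph_eq_iff h hι hA (hX.side_iff_of_adj hxy)).2 rfl
      have h1 : Y.hyperplaneOf (ξ'.map_adj h) = Y.hyperplaneOf (ξ'.map_adj hι) :=
        Quotient.sound (s := Y.parallelSetoid)
          (hpar' _ _ (Quotient.exact (s := (X.orientationGraph P).parallelSetoid) this))
      rw [h1]
      simp only [hξ']
      rfl
    have huniv := (hX.connected_orientationGraph (P := P)).eq_univ_of_adj_mem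
      (S := {σ | ξ' σ = ξ σ}) (v := hX.principalEmbedding P x₀)
      ((hξ' x₀).trans (hY.eq_of_sides fun K => hf _ K x₀ fun A _ => Iff.rfl).symm) (by
        intro σ hσ τ hστ
        have hστ' := hστ
        obtain ⟨A, hA⟩ := hστ'
        have e1 := hlabel' hστ hA
        have e2 := hlabel hστ hA
        have hσ' : ξ' σ = f σ := hσ
        have hadj' := ξ'.map_adj hστ
        have e3 : Y.hyperplaneOf hadj' = A.image ψ hψ := e1
        have : ∀ {u v : U} (hu : ξ' σ = u) (h : Y.Adj u v), Y.hyperplaneOf h = A.image ψ hψ →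
            ξ' τ = v := by
          rintro u v rfl h he
          exact hY.eq_of_hyperplaneOf_eq hadj' h (e3.trans he.symm)
        exact this hσ' (hadj hστ) e2)
    ext σ
    exact Set.eq_univ_iff_forall.1 huniv σ

end

end SimpleGraph

/-! ### Uniqueness of the completion -/

namespace SimpleGraph

variable {V W : Type*} {X : SimpleGraph V} {Z : SimpleGraph W} {P : Set (Sym2 X.Hyperplane)}
  {ι : X ↪g Z}

theorem IsIsometric.side_image_iff (hι : IsIsometric ι) (hX : X.IsMedian) (hZ : Z.IsMedian)
    (A : X.Hyperplane) (x y : V) :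
    ((A.image ι.toHom ι.parallelPreserving).side (ι x) ↔
      (A.image ι.toHom ι.parallelPreserving).side (ι y)) ↔ (A.side x ↔ A.side y) := by
  obtain ⟨a, b, hab, rfl⟩ := A.exists_adj
  have h := hZ.side_iff_side (ι.map_adj_iff.2 hab) (ι x) (ι y)
  rw [hι, hι, hι, hι] at h
  exact h.trans (hX.side_iff_side hab x y).symm

theorem IsIsometric.image_injective (hι : IsIsometric ι) (hX : X.IsMedian) (hZ : Z.IsMedian) :
    Function.Injective (Hyperplane.image ι.toHom ι.parallelPreserving) := by
  intro A B h
  refine hX.hyperplane_ext fun x y hxy => ?_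
  rw [← hι.side_image_iff hX hZ, ← h, hι.side_image_iff hX hZ]
  exact hxy

/-- A hyperplane that no edge of `X` meets leaves `X` in one halfspace. That halfspace is convex, so
it would contain the hull, which is everything. -/
theorem IsHullWithTransversality.image_surjective (h : IsHullWithTransversality P ι)
    (hX : X.IsMedian) (hZ : Z.IsMedian) :
    Function.Surjective (Hyperplane.image ι.toHom ι.parallelPreserving) := by
  intro J
  by_contra hJ
  push Not at hJ
  obtain ⟨x₀⟩ := hX.1.nonempty
  have hside := hX.1.eq_univ_of_adj_mem (S := {x | J.side (ι x) ↔ J.side (ι x₀)}) (v := x₀)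
    Iff.rfl (fun x hx y hxy =>
      (((hZ.side_iff_of_adj (ι.map_adj_iff.2 hxy) J).2
        (fun h => hJ (X.hyperplaneOf hxy) h.symm)).symm.trans hx : J.side (ι y) ↔ J.side (ι x₀)))
  have hconv : Z.IsGeodesicallyConvex {z | J.side z ↔ J.side (ι x₀)} := by
    intro x hx y hy z hz
    exact (hZ.between_iff.1 hz.symm J (hx.trans hy.symm)).trans hx
  obtain ⟨z, hz⟩ := hZ.exists_side_iff J (¬ J.side (ι x₀))
  have hmem : z ∈ Z.geodesicConvexHull (Set.range ι) := h.hull ▸ Set.mem_univ z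
  have hz' : J.side z ↔ J.side (ι x₀) := by
    refine hmem {z | J.side z ↔ J.side (ι x₀)} ⟨?_, hconv⟩
    rintro _ ⟨x, rfl⟩
    exact Set.eq_univ_iff_forall.1 hside x
  tauto

theorem iff_right_cancel {p q r : Prop} (h : (p ↔ q) ↔ (r ↔ q)) : p ↔ r := by
  by_cases q <;> simp_all [not_iff_not]

/-- Two adjacent empty quadrants would empty a halfspace; two opposite ones would make the two
partitions equal. -/
theorem IsMedian.exists_quadrant (hX : X.IsMedian) {A B : X.Hyperplane} {s t : Prop}
    (hne : A ≠ B) (h : ∀ x, (A.side x ↔ s) → ¬ (B.side x ↔ t)) {s' t' : Prop}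
    (h' : ¬ ((s' ↔ s) ∧ (t' ↔ t))) : ∃ x, (A.side x ↔ s') ∧ (B.side x ↔ t') := by
  by_contra hno
  by_cases hs : s' ↔ s
  · obtain ⟨x, hx⟩ := hX.exists_side_iff A s
    exact hno ⟨x, hx.trans hs.symm, by have := h x hx; tauto⟩
  · by_cases ht : t' ↔ t
    · obtain ⟨x, hx⟩ := hX.exists_side_iff B t
      exact hno ⟨x, by have := fun hA => h x hA hx; tauto, hx.trans ht.symm⟩
    · apply hne
      have key : ∀ x, (A.side x ↔ s) ↔ ¬ (B.side x ↔ t) := fun x => by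
        refine ⟨h x, fun hB => ?_⟩
        by_contra hA
        exact hno ⟨x, by tauto, by tauto⟩
      refine hX.hyperplane_ext fun x y hxy => ?_
      have := (key x).symm.trans ((iff_congr hxy Iff.rfl).trans (key y))
      exact iff_right_cancel (not_iff_not.1 this)

/-- The completion is determined by its hull and transversality properties. -/
theorem IsHullWithTransversality.exists_iso (h : IsHullWithTransversality P ι)
    (hX : X.IsMedian) (hZ : Z.IsMedian) (hι : IsIsometric ι) :
    ∃ φ : X.orientationGraph P ≃g Z, ∀ x, φ (hX.principalEmbedding P x) = ι x := by
  obtain ⟨x₀⟩ := hX.1.nonempty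
  have hinj := hι.image_injective hX hZ
  have hsurj := h.image_surjective hX hZ
  set im := Hyperplane.image ι.toHom ι.parallelPreserving with him
  -- The `side` predicates of `A` and of `im A` rest on unrelated choices; comparing both at `x₀`
  -- corrects a possible swap.
  let lab : W → X.Hyperplane → Prop := fun z A =>
    (im A).side z ↔ ((im A).side (ι x₀) ↔ A.side x₀)
  have hlab : ∀ z w A, (lab z A ↔ lab w A) ↔ ((im A).side z ↔ (im A).side w) := by
    intro z w A
    change (((im A).side z ↔ _) ↔ ((im A).side w ↔ _)) ↔ _
    tauto
  have hlabι : ∀ x A, lab (ι x) A ↔ A.side x := by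
    intro x A
    have := hι.side_image_iff hX hZ A x x₀
    change ((im A).side (ι x) ↔ ((im A).side (ι x₀) ↔ A.side x₀)) ↔ _
    rw [← him] at this
    tauto
  let f : W → X.Orientation P := fun z =>
    { label := lab z
      finite := fun x => by
        refine ((hZ.finite_disagreement (ι x) z).preimage hinj.injOn).subset fun A hA => ?_
        rw [mem_disagreement] at hA
        change ¬ ((im A).side (ι x) ↔ (im A).side z)
        rw [← hlab, hlabι]
        exact hA
      realized := fun A B hAB => by
        by_contra hno
        have hno' : ∀ x, (A.side x ↔ lab z A) → ¬ (B.side x ↔ lab z B) :=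
          fun x h1 h2 => hno ⟨x, h1, h2⟩
        have hne : A ≠ B := by
          rintro rfl
          obtain ⟨x, hx⟩ := hX.exists_side_iff A (lab z A)
          exact hno' x hx hx
        -- `X` misses the quadrant of `z`, so it meets the other three; with `z` itself all four are
        -- nonempty in `Z`.
        have htr : Z.Transverse (im A) (im B) := by
          rw [hZ.transverse_iff]
          have hquad : ∀ s t : Prop, ∃ w, (lab w A ↔ s) ∧ (lab w B ↔ t) := by
            intro s t
            by_cases hst : (s ↔ lab z A) ∧ (t ↔ lab z B)
            · exact ⟨z, hst.1.symm, hst.2.symm⟩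
            · obtain ⟨x, h1, h2⟩ := hX.exists_quadrant hne hno' hst
              exact ⟨ι x, (hlabι x A).trans h1, (hlabι x B).trans h2⟩
          intro s t
          obtain ⟨w, h1, h2⟩ := hquad (s ↔ ((im A).side (ι x₀) ↔ A.side x₀))
            (t ↔ ((im B).side (ι x₀) ↔ B.side x₀))
          exact ⟨w, iff_right_cancel h1, iff_right_cancel h2⟩
        obtain ⟨A', B', hA, hB, h'⟩ := (h.transverse_iff _ _).1 htr
        rw [hinj hA, hinj hB] at h'
        rcases h' with h' | h'
        · exact hno (hX.transverse_iff.1 h' _ _)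
        · exact hAB h' }
  have hfinj : Function.Injective f := by
    intro z w hzw
    refine hZ.eq_of_sides fun J => ?_
    obtain ⟨A, rfl⟩ := hsurj J
    exact (hlab z w A).1 (Orientation.eq_iff.1 hzw A)
  have hfsurj : Function.Surjective f := by
    intro σ
    choose r hr using hsurj
    have hpair : ∀ K ∈ Set.univ, ∀ L ∈ Set.univ, ∃ z : W,
        (K.side z ↔ (σ.label (r K) ↔ (K.side (ι x₀) ↔ (r K).side x₀))) ∧
        (L.side z ↔ (σ.label (r L) ↔ (L.side (ι x₀) ↔ (r L).side x₀))) := by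
      intro K _ L _
      -- A pair in `P` is transverse in `Z`, so any two sides meet; any other pair of labels is
      -- realized by a vertex of `X`.
      by_cases hKL : s(r K, r L) ∈ P
      · exact hZ.transverse_iff.1 ((h.transverse_iff K L).2 ⟨r K, r L, hr K, hr L, Or.inr hKL⟩)
          _ _
      · obtain ⟨x, h1, h2⟩ := σ.realized _ _ hKL
        refine ⟨ι x, ?_, ?_⟩
        · have := hlabι x (r K)
          change (((im (r K)).side (ι x) ↔ ((im (r K)).side (ι x₀) ↔ _)) ↔ _) at this
          rw [hr] at this
          rw [← h1]
          tauto
        · have := hlabι x (r L)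
          change (((im (r L)).side (ι x) ↔ ((im (r L)).side (ι x₀) ↔ _)) ↔ _) at this
          rw [hr] at this
          rw [← h2]
          tauto
    have hfin : {K ∈ Set.univ | ¬ (K.side (ι x₀) ↔
        (σ.label (r K) ↔ (K.side (ι x₀) ↔ (r K).side x₀)))}.Finite := by
      refine ((σ.finite x₀).image im).subset ?_
      rintro K ⟨-, hK⟩
      refine ⟨r K, ?_, hr K⟩
      rw [mem_disagreement]
      change ¬ ((r K).side x₀ ↔ _)
      tauto
    obtain ⟨z, hz⟩ := hZ.exists_forall_side_iff Set.univ _ (ι x₀) hfin hpair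
    refine ⟨z, Orientation.eq_iff.2 fun A => ?_⟩
    have := hz (im A) trivial
    rw [hinj (hr (im A))] at this
    change ((im A).side z ↔ _) ↔ _
    tauto
  let e : W ≃ X.Orientation P := Equiv.ofBijective f ⟨hfinj, hfsurj⟩
  have hadj : ∀ z w, (X.orientationGraph P).Adj (e z) (e w) ↔ Z.Adj z w := by
    intro z w
    constructor
    · rintro ⟨A, hA⟩
      rw [← dist_eq_one_iff_adj, ← hZ.ncard_disagreement, Set.ncard_eq_one]
      refine ⟨im A, Set.ext fun J => ?_⟩
      obtain ⟨B, rfl⟩ := hsurj J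
      rw [mem_disagreement, Set.mem_singleton_iff, hinj.eq_iff]
      exact ((hlab z w B).symm.trans (hA B)).not.trans not_not
    · intro hzw
      obtain ⟨A, hA⟩ := hsurj (Z.hyperplaneOf hzw)
      refine ⟨A, fun B => (hlab z w B).trans ?_⟩
      rw [hZ.side_iff_of_adj hzw, ← hA, hinj.ne_iff]
  refine ⟨(⟨e, hadj _ _⟩ : Z ≃g X.orientationGraph P).symm, fun x => ?_⟩
  refine e.symm_apply_eq.2 (Orientation.eq_iff.2 fun A => (hlabι x A).symm)

end SimpleGraph

theorem theorem4p1 {V : Type u} [Countable V] (X : SimpleGraph V) (hX : X.IsMedian)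
    (P : Set (Sym2 X.Hyperplane))
    (hP : ∀ A B : X.Hyperplane, s(A, B) ∈ P → X.Tangent A B) :
    ∃ (W : Type u) (Z : SimpleGraph W) (ι : X ↪g Z),
      Z.IsMedian ∧
      SimpleGraph.IsIsometric ι ∧
      -- universal property
      (∀ (U : Type v) (Y : SimpleGraph U), Y.IsMedian →
        ∀ (ψ : X →g Y) (hψ : SimpleGraph.ParallelPreserving ψ),
          (∀ A B : X.Hyperplane, s(A, B) ∈ P →
            Y.Transverse (SimpleGraph.Hyperplane.image ψ hψ A)
              (SimpleGraph.Hyperplane.image ψ hψ B)) →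
          ∃! ξ : Z →g Y, SimpleGraph.ParallelPreserving ξ ∧ ∀ x : V, ξ (ι x) = ψ x) ∧
      -- convex hull and transversality, and uniqueness up to an isomorphism fixing `X`
      SimpleGraph.IsHullWithTransversality P ι ∧
      (∀ (W' : Type w) (Z' : SimpleGraph W') (ι' : X ↪g Z'), Z'.IsMedian →
        SimpleGraph.IsIsometric ι' → SimpleGraph.IsHullWithTransversality P ι' →
          ∃ φ : Z ≃g Z', ∀ x : V, φ (ι x) = ι' x) := by
  exact ⟨X.Orientation P, X.orientationGraph P, hX.principalEmbedding P,
    hX.isMedian_orientationGraph, hX.isIsometric_principalEmbedding,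
    fun U Y hY ψ hψ h => hX.existsUnique_extension hY hψ h,
    hX.isHullWithTransversality_principalEmbedding hP,
    fun W' Z' ι' hZ' hι' h => h.exists_iso hX hZ' hι'⟩
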